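/- **Theorem 5.1.** Let $N\ge n\ge 1$, and let $\mathbb B^k$ be the open unit ball of $\mathbb C^k$ with the Euclidean norm and $\mathrm{Aut}(\mathbb B^k)$ its group of biholomorphic self-maps. Let $f:\mathbb B^n\to\mathbb B^N$ be a rational holomorphic proper map, that is, a proper map of the form $f=p/q$ with $p=(p_1,\dots,p_N)$ a tuple of complex polynomials and $q$ a complex polynomial without zeros in $\mathbb B^n$. Let $$\Gamma_f=\{\gamma\in\mathrm{Aut}(\mathbb B^n) : f\circ\gamma=\psi\circ f \text{ for some } \psi\in\mathrm{Aut}(\mathbb B^N)\}$$ be its Hermitian invariant group. Let $\mathbf U(1)\oplus\dots\oplus\mathbf U(1)\leqslant\mathrm{Aut}(\mathbb B^n)$ ($n$ summands) be the group of the maps $(z_1,\dots,z_n)\mapsto(u_1z_1,\dots,u_nz_n)$ with $|u_1|=\dots=|u_n|=1$. Then $\Gamma_f$ contains a conjugate in $\mathrm{Aut}(\mathbb B^n)$ of $\mathbf U(1)\oplus\dots\oplus\mathbf U(1)$ if and only if $f$ is spherically equivalent to a monomial map, that is, if and only if there are a proper map $g:\mathbb B^n\to\mathbb B^N$, each of whose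 components has the form $c\,z_1^{\alpha_1}\cdots z_n^{\alpha_n}$ with $c\in\mathbb C$ (possibly $0$) and integers $\alpha_i\ge 0$, and automorphisms $\varphi\in\mathrm{Aut}(\mathbb B^n)$, $\chi\in\mathrm{Aut}(\mathbb B^N)$ with $f=\chi\circ g\circ\varphi$. -/

import Mathlib

/-- The open unit ball `𝔹ⁿ` in `ℂⁿ` with its Euclidean norm, as a type. -/
abbrev UnitBall (n : ℕ) : Type :=
  Metric.ball (0 : EuclideanSpace ℂ (Fin n)) 1

/-- A map between unit balls is holomorphic if it is the restriction of a function that is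
complex differentiable on the (open) source ball. -/
def IsHolomorphicBallMap {n m : ℕ} (f : UnitBall n → UnitBall m) : Prop :=
  ∃ F : EuclideanSpace ℂ (Fin n) → EuclideanSpace ℂ (Fin m),
    DifferentiableOn ℂ F (Metric.ball 0 1) ∧
      ∀ z : UnitBall n, F z = (f z : EuclideanSpace ℂ (Fin m))

theorem IsHolomorphicBallMap.comp {n m k : ℕ} {g : UnitBall m → UnitBall k}
    {f : UnitBall n → UnitBall m} (hg : IsHolomorphicBallMap g) (hf : IsHolomorphicBallMap f) :
    IsHolomorphicBallMap (fun z => g (f z)) := by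
  obtain ⟨G, hG, hGg⟩ := hg
  obtain ⟨F, hF, hFf⟩ := hf
  refine ⟨fun z => G (F z), hG.comp hF ?_, fun z => ?_⟩
  · intro z hz
    rw [hFf ⟨z, hz⟩]
    exact (f ⟨z, hz⟩).2
  · change G (F z) = _
    rw [hFf z, hGg (f z)]

/-- The holomorphic automorphism group `Aut(𝔹ⁿ)`: the bijections of the ball onto itself that are
holomorphic together with their inverse; the group operation is composition. -/
def BallAut (n : ℕ) : Subgroup (Equiv.Perm (UnitBall n)) where
  carrier := {γ | IsHolomorphicBallMap (fun z => γ z) ∧ IsHolomorphicBallMap (fun z => γ⁻¹ z)}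
  one_mem' := ⟨⟨id, differentiableOn_id, fun _ => rfl⟩, ⟨id, differentiableOn_id, fun _ => rfl⟩⟩
  mul_mem' := by
    rintro a b ⟨ha, ha'⟩ ⟨hb, hb'⟩
    refine ⟨ha.comp hb, ?_⟩
    rw [mul_inv_rev]
    exact hb'.comp ha'
  inv_mem' := by
    rintro a ⟨ha, ha'⟩
    exact ⟨ha', by simpa using ha⟩

/-- `f = p / q` with `p` a tuple of polynomials and `q` a polynomial without zeros in the ball. -/
def IsRationalBallMap {n N : ℕ} (f : UnitBall n → UnitBall N) : Prop :=
  ∃ (p : Fin N → MvPolynomial (Fin n) ℂ) (q : MvPolynomial (Fin n) ℂ),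
    ∀ z : UnitBall n, MvPolynomial.eval (fun i => z.1 i) q ≠ 0 ∧
      ∀ j, (f z).1 j =
        MvPolynomial.eval (fun i => z.1 i) (p j) / MvPolynomial.eval (fun i => z.1 i) q

/-- Every component of `f` is a complex constant (possibly zero) times a monomial `z ^ α`. -/
def IsMonomialBallMap {n N : ℕ} (f : UnitBall n → UnitBall N) : Prop :=
  ∃ (c : Fin N → ℂ) (α : Fin N → Fin n → ℕ),
    ∀ (z : UnitBall n) (j : Fin N), (f z).1 j = c j * ∏ i, z.1 i ^ α j i

/-- `f = χ ∘ g ∘ φ` for some automorphisms `φ` of the source and `χ` of the target. -/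
def SphericallyEquivalent {n N : ℕ} (f g : UnitBall n → UnitBall N) : Prop :=
  ∃ (φ : BallAut n) (χ : BallAut N), ∀ z, f z = χ.1 (g (φ.1 z))

/-- The Hermitian invariant group `Γ_f`: all source automorphisms `γ` for which there is a target
automorphism `ψ` with `f ∘ γ = ψ ∘ f`. -/
def hermitianInvariantGroup {n N : ℕ} (f : UnitBall n → UnitBall N) : Subgroup (BallAut n) where
  carrier := {γ | ∃ ψ : BallAut N, ∀ z, f (γ.1 z) = ψ.1 (f z)}
  one_mem' := ⟨1, fun _ => rfl⟩
  mul_mem' := by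
    rintro a b ⟨ψ, hψ⟩ ⟨χ, hχ⟩
    refine ⟨ψ * χ, fun z => ?_⟩
    change f (a.1 (b.1 z)) = ψ.1 (χ.1 (f z))
    rw [hψ, hχ]
  inv_mem' := by
    rintro a ⟨ψ, hψ⟩
    refine ⟨ψ⁻¹, fun z => ?_⟩
    change f (a.1⁻¹ z) = ψ.1⁻¹ (f z)
    rw [Equiv.Perm.eq_inv_iff_eq, ← hψ]
    simp

/-- The standard torus `U(1) ⊕ ⋯ ⊕ U(1)` (`n` summands) in `Aut(𝔹ⁿ)`: all the maps
`(z₁, …, zₙ) ↦ (u₁ z₁, …, uₙ zₙ)` with every `uᵢ` on the unit circle. -/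
def standardTorus (n : ℕ) : Subgroup (BallAut n) where
  carrier := {γ | ∃ u : Fin n → Circle, ∀ (z : UnitBall n) (i : Fin n),
    (γ.1 z).1 i = (u i : ℂ) * z.1 i}
  one_mem' := ⟨1, fun z i => by simp⟩
  mul_mem' := by
    rintro a b ⟨u, hu⟩ ⟨v, hv⟩
    refine ⟨u * v, fun z i => ?_⟩
    change (a.1 (b.1 z)).1 i = _
    rw [hu, hv]
    simp [mul_assoc]
  inv_mem' := by
    rintro a ⟨u, hu⟩
    refine ⟨u⁻¹, fun z i => ?_⟩
    change (a.1⁻¹ z).1 i = _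
    have h := hu (a.1⁻¹ z) i
    rw [show a.1 (a.1⁻¹ z) = z from a.1.apply_symm_apply z] at h
    rw [h]
    simp

/-! A diagonal rotation of the source multiplies each monomial by a unimodular constant, so a
monomial map intertwines it with a diagonal rotation of the target. Spherical equivalence only
conjugates this symmetry, which gives one direction.

Conversely, automorphisms on both sides reduce to a map that sends 0 to 0 and whose invariant group
contains the standard torus. The target automorphism paired with a rotation `u` then fixes 0, so by
Cartan's theorem (`exists_linearIsometry_of_map_center`) it is a linear isometry `U`. Comparing
Taylor coefficients `C α` at 0 gives `U (C α) = u ^ α • C α` (`taylorVector_equivariant`).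
Eigenvectors of an isometry for distinct eigenvalues are orthogonal, and some `u` separates any two
multi-indices, so the `C α` are pairwise orthogonal (`taylorVector_inner_eq_zero`). In an
orthonormal basis extending the normalised nonzero `C α`, each component of the map sees at most one
Taylor coefficient and is a monomial. Each `u` is treated separately, so `U` need not depend on `u`
in any regular way. -/

open Metric

/-! ### Möbius transformations of the ball -/

section Moebius
variable {E : Type*} [NormedAddCommGroup E] [InnerProductSpace ℂ E]

/-- The Möbius transformation of the unit ball taking `0` to `a`. -/
noncomputable def ballMoebius (a z : E) : E :=
  (1 + inner ℂ a z)⁻¹ • (a + ((√(1 - ‖a‖ ^ 2) : ℝ) : ℂ) • z +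
    (inner ℂ a z / (1 + ((√(1 - ‖a‖ ^ 2) : ℝ) : ℂ))) • a)

theorem one_add_inner_ne_zero {a z : E} (ha : ‖a‖ < 1) (hz : ‖z‖ < 1) :
    1 + inner ℂ a z ≠ 0 := by
  intro h
  have h1 : ‖inner ℂ a z‖ ≤ ‖a‖ * ‖z‖ := norm_inner_le_norm a z
  have h2 : inner ℂ a z = -1 := by linear_combination h
  rw [h2, norm_neg, norm_one] at h1
  nlinarith [norm_nonneg a, norm_nonneg z]

theorem one_add_ofReal_sqrt_ne_zero (x : ℝ) : (1 + ((√x : ℝ) : ℂ)) ≠ 0 := by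
  have : (0 : ℝ) < 1 + √x := by positivity
  exact_mod_cast this.ne'

theorem ofReal_sqrt_one_sub_sq {E : Type*} [NormedAddCommGroup E] {a : E} (ha : ‖a‖ < 1) :
    ((√(1 - ‖a‖ ^ 2) : ℝ) : ℂ) ^ 2 = 1 - (‖a‖ : ℂ) ^ 2 := by
  have h : 0 ≤ 1 - ‖a‖ ^ 2 := by nlinarith [norm_nonneg a]
  exact_mod_cast Real.sq_sqrt h

theorem inner_ballMoebius {a z : E} (ha : ‖a‖ < 1) (hz : ‖z‖ < 1) :
    inner ℂ a (ballMoebius a z) = ((‖a‖ : ℂ) ^ 2 + inner ℂ a z) / (1 + inner ℂ a z) := by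
  have h1 := one_add_inner_ne_zero ha hz
  have h2 := one_add_ofReal_sqrt_ne_zero (1 - ‖a‖ ^ 2)
  have h3 := ofReal_sqrt_one_sub_sq ha
  simp only [ballMoebius, inner_smul_right, inner_add_right, inner_self_eq_norm_sq_to_K,
    Complex.coe_algebraMap]
  generalize ((√(1 - ‖a‖ ^ 2) : ℝ) : ℂ) = s at *
  field_simp
  linear_combination (inner ℂ a z : ℂ) * h3

/-- Both sides are combinations of `a` and `z` with coefficients rational in `s = √(1 - ‖a‖²)` and
`t = ⟨a, z⟩`, so it is enough to compare coefficients using `‖a‖² = 1 - s²`. -/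
theorem ballMoebius_neg_ballMoebius {a z : E} (ha : ‖a‖ < 1) (hz : ‖z‖ < 1) :
    ballMoebius (-a) (ballMoebius a z) = z := by
  have h1 := one_add_inner_ne_zero ha hz
  have h2 := one_add_ofReal_sqrt_ne_zero (1 - ‖a‖ ^ 2)
  have h3 := ofReal_sqrt_one_sub_sq ha
  have h4 : ((√(1 - ‖a‖ ^ 2) : ℝ) : ℂ) ≠ 0 := by
    have : (0 : ℝ) < 1 - ‖a‖ ^ 2 := by nlinarith [norm_nonneg a]
    exact_mod_cast (Real.sqrt_pos.2 this).ne'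
  have h5 := inner_ballMoebius ha hz
  rw [ballMoebius]
  simp only [inner_neg_left, norm_neg, h5]
  rw [ballMoebius]
  generalize ((√(1 - ‖a‖ ^ 2) : ℝ) : ℂ) = s at *
  generalize (inner ℂ a z : ℂ) = t at *
  have h6 : (‖a‖ : ℂ) ^ 2 = 1 - s ^ 2 := by linear_combination h3
  have h7 : (1 + -((1 - s ^ 2 + t) / (1 + t))) = s ^ 2 / (1 + t) := by field_simp; ring
  rw [h6, h7]
  match_scalars <;> field_simp
  ring

theorem norm_ballMoebius_lt_one {a z : E} (ha : ‖a‖ < 1) (hz : ‖z‖ < 1) :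
    ‖ballMoebius a z‖ < 1 := by
  have h1 := one_add_inner_ne_zero ha hz
  have h0 : 0 < 1 - ‖a‖ ^ 2 := by nlinarith [norm_nonneg a]
  have h3 := Real.sq_sqrt h0.le
  have hs := Real.sqrt_pos.2 h0
  rw [ballMoebius, norm_smul, norm_inv, inv_mul_lt_iff₀ (norm_pos_iff.2 h1), mul_one]
  refine lt_of_pow_lt_pow_left₀ 2 (norm_nonneg _) ?_
  -- The classical identity `|denominator|² - ‖numerator‖² = (1 - ‖a‖²)(1 - ‖z‖²)`.
  have key : ‖a + ((√(1 - ‖a‖ ^ 2) : ℝ) : ℂ) • z +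
      (inner ℂ a z / (1 + ((√(1 - ‖a‖ ^ 2) : ℝ) : ℂ))) • a‖ ^ 2
      = ‖1 + inner ℂ a z‖ ^ 2 - (√(1 - ‖a‖ ^ 2)) ^ 2 * (1 - ‖z‖ ^ 2) := by
    have h2 := one_add_ofReal_sqrt_ne_zero (1 - ‖a‖ ^ 2)
    have h3' := ofReal_sqrt_one_sub_sq ha
    apply Complex.ofReal_injective
    push_cast
    have hsq (x : E) : (‖x‖ : ℂ) ^ 2 = inner ℂ x x := (inner_self_eq_norm_sq_to_K x).symm
    rw [← Complex.conj_mul' (1 + _), hsq (_ + _)]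
    simp only [inner_smul_right, inner_add_right, inner_smul_left, inner_add_left,
      map_div₀, map_add, map_one, Complex.conj_ofReal, inner_conj_symm]
    rw [← hsq a, ← hsq z]
    generalize ((√(1 - ‖a‖ ^ 2) : ℝ) : ℂ) = s at *
    generalize (inner ℂ a z : ℂ) = t at *
    generalize (inner ℂ z a : ℂ) = t' at *
    have h6 : (‖a‖ : ℂ) ^ 2 = 1 - s ^ 2 := by linear_combination h3'
    rw [h6]
    field_simp
    ring
  rw [key]
  have : 0 < (√(1 - ‖a‖ ^ 2)) ^ 2 * (1 - ‖z‖ ^ 2) := by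
    have : 0 < 1 - ‖z‖ ^ 2 := by nlinarith [norm_nonneg z]
    positivity
  linarith

theorem ballMoebius_zero (a : E) : ballMoebius a 0 = a := by
  simp [ballMoebius]

theorem analyticOnNhd_ballMoebius {a : E} (ha : ‖a‖ < 1) :
    AnalyticOnNhd ℂ (ballMoebius a) (ball 0 1) := by
  intro z hz
  have h1 := one_add_inner_ne_zero ha (mem_ball_zero_iff.1 hz)
  have h2 : AnalyticAt ℂ (fun z => inner ℂ a z) z := (innerSL ℂ a).analyticAt z
  unfold ballMoebius
  refine AnalyticAt.smul ((analyticAt_const.add h2).inv h1) ?_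
  exact (analyticAt_const.add (analyticAt_const.smul analyticAt_id)).add
    ((h2.div analyticAt_const (one_add_ofReal_sqrt_ne_zero _)).smul analyticAt_const)

end Moebius

/-! ### Norm-preserving holomorphic maps -/

section Cartan
variable {E F : Type*} [NormedAddCommGroup E] [NormedSpace ℂ E] [NormedAddCommGroup F]
  [NormedSpace ℂ F] [StrictConvexSpace ℝ F]

/-- A holomorphic map on the unit ball preserving the norm is linear. -/
theorem eqOn_fderiv_of_norm_eq {f : E → F} (hd : DifferentiableOn ℂ f (ball 0 1))
    (hf : ∀ z ∈ ball (0 : E) 1, ‖f z‖ = ‖z‖) {z : E} (hz : z ∈ ball (0 : E) 1) :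
    f z = fderiv ℂ f 0 z := by
  have hf0 : f 0 = 0 := by simpa using hf 0 (by simp)
  rcases eq_or_ne z 0 with rfl | hz0
  · simp [hf0]
  have hzn : ‖z‖ ≠ 0 := norm_ne_zero_iff.2 hz0
  have hzc : (‖z‖ : ℂ) ≠ 0 := by exact_mod_cast hzn
  have hz1 : ‖z‖ < 1 := mem_ball_zero_iff.1 hz
  set e : E := (‖z‖ : ℂ)⁻¹ • z with he
  have hen : ‖e‖ = 1 := by simp [he, norm_smul, hzn]
  have hmaps : ∀ w ∈ ball (0 : ℂ) 1, w • e ∈ ball (0 : E) 1 := by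
    intro w hw
    simpa [norm_smul, hen] using hw
  set g : ℂ → F := fun w => f (w • e) with hg
  have hgd : DifferentiableOn ℂ g (ball 0 1) :=
    hd.comp (differentiable_id.smul_const e).differentiableOn hmaps
  have hg0 : g 0 = 0 := by simp [hg, hf0]
  have hgn : ∀ w ∈ ball (0 : ℂ) 1, ‖g w‖ = ‖w‖ := by
    intro w hw
    rw [hg, hf _ (hmaps w hw), norm_smul, hen, mul_one]
  have hzb : (‖z‖ : ℂ) ∈ ball (0 : ℂ) 1 := by simpa using hz1
  -- Equality case of the Schwarz lemma on the complex line through `z`: the slope attains its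
  -- maximal norm, so `g` is affine.
  have hsl : ‖dslope g 0 (‖z‖ : ℂ)‖ = 1 / 1 := by
    rw [dslope_of_ne _ hzc, slope_def_module, hg0, norm_smul, sub_zero, sub_zero, hgn _ hzb]
    simp [hzn]
  have haff := Complex.affine_of_mapsTo_ball_of_norm_dslope_eq_div hgd (R₂ := 1) (by
    intro w hw
    rw [hg0, mem_closedBall_zero_iff, hgn w hw]
    exact (mem_ball_zero_iff.1 hw).le) hzb hsl
  set v := dslope g 0 (‖z‖ : ℂ)
  have hder : HasDerivAt g v 0 := by
    have h1 : HasDerivAt (fun w : ℂ => w • v) v 0 := by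
      simpa using (hasDerivAt_id (0 : ℂ)).smul_const v
    refine h1.congr_of_eventuallyEq ?_
    filter_upwards [ball_mem_nhds (0 : ℂ) one_pos] with w hw
    simpa [hg0] using haff hw
  -- Computing `g'(0)` also by the chain rule identifies the slope with the derivative of `f` along
  -- `e`.
  have hder' : HasDerivAt g (fderiv ℂ f 0 e) 0 := by
    have h1 : HasDerivAt (fun w : ℂ => w • e) e 0 := by
      simpa using (hasDerivAt_id (0 : ℂ)).smul_const e
    have h2 : HasFDerivAt f (fderiv ℂ f 0) ((0 : ℂ) • e) := by
      rw [zero_smul]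
      exact (hd.differentiableAt (ball_mem_nhds _ one_pos)).hasFDerivAt
    exact h2.comp_hasDerivAt 0 h1
  have hze : (‖z‖ : ℂ) • e = z := by rw [he, smul_smul, mul_inv_cancel₀ hzc, one_smul]
  have h3 : f z = (‖z‖ : ℂ) • v := by
    have := haff hzb
    simpa [hf0, hg, hze] using this
  rw [h3, hder.unique hder', ← map_smul, hze]

theorem exists_linearIsometry_of_norm_eq {f : E → F} (hd : DifferentiableOn ℂ f (ball 0 1))
    (hf : ∀ z ∈ ball (0 : E) 1, ‖f z‖ = ‖z‖) :
    ∃ L : E →ₗᵢ[ℂ] F, ∀ z ∈ ball (0 : E) 1, f z = L z := by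
  refine ⟨⟨(fderiv ℂ f 0 : E →ₗ[ℂ] F), fun z => ?_⟩, fun z hz => eqOn_fderiv_of_norm_eq hd hf hz⟩
  -- Dividing by `1 + ‖z‖` brings any vector into the ball; homogeneity carries the norm identity
  -- back.
  have hpos : 0 < 1 + ‖z‖ := by positivity
  have hpc : ‖((1 + ‖z‖ : ℝ) : ℂ)‖ = 1 + ‖z‖ := by
    rw [Complex.norm_real, Real.norm_of_nonneg hpos.le]
  have hb : (((1 + ‖z‖ : ℝ) : ℂ)⁻¹ • z) ∈ ball (0 : E) 1 := by
    rw [mem_ball_zero_iff, norm_smul, norm_inv, hpc, inv_mul_lt_iff₀ hpos]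
    linarith
  have h := hf _ hb
  rw [eqOn_fderiv_of_norm_eq hd hf hb, map_smul, norm_smul, norm_smul] at h
  have h0 : ‖((1 + ‖z‖ : ℝ) : ℂ)⁻¹‖ ≠ 0 := by
    rw [norm_inv, hpc]
    positivity
  exact mul_left_cancel₀ h0 h

end Cartan

/-! ### Orthonormal bases adapted to orthogonal families -/

section Orthogonal
variable {E : Type*} [NormedAddCommGroup E] [InnerProductSpace ℂ E] [FiniteDimensional ℂ E]

/-- A pairwise orthogonal family admits an orthonormal basis of the space each of whose vectors
is orthogonal to all members of the family but at most one. -/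
theorem exists_orthonormalBasis_of_pairwise_inner_eq_zero {ι : Type*} [Nonempty ι] {N : ℕ}
    (hN : Module.finrank ℂ E = N) (C : ι → E)
    (hC : Pairwise fun i j => inner ℂ (C i) (C j) = 0) :
    ∃ (b : OrthonormalBasis (Fin N) ℂ E) (k : Fin N → ι),
      ∀ j i, i ≠ k j → inner ℂ (b j) (C i) = 0 := by
  have hv : Orthonormal ℂ
      ((↑) : {x : E | ∃ i, C i ≠ 0 ∧ x = ((‖C i‖ : ℂ)⁻¹) • C i} → E) := by
    constructor
    · rintro ⟨x, i, hi, rfl⟩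
      simp [norm_smul, hi]
    · rintro ⟨x, i, hi, rfl⟩ ⟨y, j, hj, rfl⟩ hne
      have hij : i ≠ j := by
        rintro rfl
        exact hne rfl
      simp [inner_smul_left, inner_smul_right, hC hij]
  obtain ⟨u, b, hu, hb⟩ := hv.exists_orthonormalBasis_extension
  have hcard : Fintype.card u = Fintype.card (Fin N) := by
    rw [Fintype.card_fin, ← hN, Module.finrank_eq_card_basis b.toBasis]
  let b' := b.reindex (Fintype.equivOfCardEq hcard)
  -- The normalisation of `C i` is itself a basis vector, so every other basis vector is orthogonal
  -- to `C i`.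
  have key : ∀ j i, inner ℂ (b' j) (C i) ≠ 0 → b' j = ((‖C i‖ : ℂ)⁻¹) • C i := by
    intro j i h
    have hi : C i ≠ 0 := by
      rintro h0
      simp [h0] at h
    by_contra hne
    have hmem : ((‖C i‖ : ℂ)⁻¹) • C i ∈ u := hu ⟨i, hi, rfl⟩
    have h2 : b ⟨_, hmem⟩ = ((‖C i‖ : ℂ)⁻¹) • C i := by rw [hb]
    have h3 : b' j = b ((Fintype.equivOfCardEq hcard).symm j) := by simp [b']
    rw [h3] at hne h
    have h4 : (Fintype.equivOfCardEq hcard).symm j ≠ ⟨_, hmem⟩ := by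
      intro h5
      rw [h5] at hne
      exact hne h2
    have h5 : inner ℂ (b _) (b _) = 0 := b.orthonormal.2 h4
    rw [h2, inner_smul_right] at h5
    have hi' : (‖C i‖ : ℂ)⁻¹ ≠ 0 := by simpa using hi
    exact h ((mul_eq_zero.1 h5).resolve_left hi')
  have hex : ∀ j, ∃ k, ∀ i, i ≠ k → inner ℂ (b' j) (C i) = 0 := by
    intro j
    by_cases hj : ∃ k, inner ℂ (b' j) (C k) ≠ 0
    · obtain ⟨k, hk⟩ := hj
      refine ⟨k, fun i hik => ?_⟩
      rw [key j k hk, inner_smul_left, hC hik.symm, mul_zero]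
    · push Not at hj
      -- This basis vector is orthogonal to the whole family, so any index serves.
      exact ⟨Classical.arbitrary ι, fun i _ => hj i⟩
  choose k hk using hex
  exact ⟨b', k, hk⟩

end Orthogonal

/-! ### Taylor coefficients and torus weights -/

theorem exists_circle_pow_ne_pow {a b : ℕ} (h : a ≠ b) : ∃ w : Circle, w ^ a ≠ w ^ b := by
  wlog hab : b < a generalizing a b
  · obtain ⟨w, hw⟩ := this h.symm (by omega)
    exact ⟨w, hw.symm⟩
  obtain ⟨d, rfl⟩ := Nat.exists_eq_add_of_lt hab
  -- Here `a - b = d + 1`, and this `w` satisfies `w ^ (d + 1) = -1`.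
  refine ⟨Circle.exp (Real.pi / (d + 1)), fun h => ?_⟩
  rw [add_assoc, pow_add] at h
  have h1 : Circle.exp (Real.pi / (d + 1)) ^ (d + 1) = 1 := by simpa using h
  have h2 := congrArg (fun w : Circle => (w : ℂ)) h1
  have h3 : ((d : ℂ) + 1) ≠ 0 := by exact_mod_cast Nat.succ_ne_zero d
  simp only [Circle.coe_pow, Circle.coe_exp, ← Complex.exp_nat_mul, Circle.coe_one] at h2
  push_cast at h2
  rw [show ((d : ℂ) + 1) * (Real.pi / (d + 1) * Complex.I) = Real.pi * Complex.I by
    field_simp, Complex.exp_pi_mul_I] at h2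
  norm_num at h2

section Taylor
variable {n : ℕ} {F : Type*} [NormedAddCommGroup F]

/-- The number of times each index occurs in a finite sequence. -/
def multiIndex {k : ℕ} (σ : Fin k → Fin n) (i : Fin n) : ℕ :=
  (Finset.univ.filter fun j => σ j = i).card

theorem prod_comp_eq_prod_pow_multiIndex {k : ℕ} (σ : Fin k → Fin n) {M : Type*} [CommMonoid M]
    (z : Fin n → M) : ∏ j, z (σ j) = ∏ i, z i ^ multiIndex σ i := by
  rw [← Finset.prod_fiberwise Finset.univ σ]
  refine Finset.prod_congr rfl fun i _ => ?_
  rw [multiIndex, ← Finset.prod_const]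
  exact Finset.prod_congr rfl fun j hj => by rw [(Finset.mem_filter.1 hj).2]

theorem sum_multiIndex {k : ℕ} (σ : Fin k → Fin n) : ∑ i, multiIndex σ i = k := by
  simp only [multiIndex]
  rw [← Finset.card_eq_sum_card_fiberwise (fun _ _ => Finset.mem_coe.2 (Finset.mem_univ _))]
  simp

/-- The linear isometry multiplying the coordinates by unimodular numbers. -/
noncomputable def diagIsometry (u : Fin n → Circle) :
    EuclideanSpace ℂ (Fin n) ≃ₗᵢ[ℂ] EuclideanSpace ℂ (Fin n) where
  toFun z := WithLp.toLp 2 fun i => (u i : ℂ) * z i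
  invFun z := WithLp.toLp 2 fun i => (u i : ℂ)⁻¹ * z i
  left_inv z := by ext i; simp
  right_inv z := by ext i; simp
  map_add' x y := by ext i; simp [mul_add]
  map_smul' c x := by ext i; simp; ring
  norm_map' z := by
    change ‖(WithLp.toLp 2 fun i => (u i : ℂ) * z i : EuclideanSpace ℂ (Fin n))‖ = ‖z‖
    simp only [EuclideanSpace.norm_eq, norm_mul, Circle.norm_coe, one_mul]

theorem diagIsometry_apply (u : Fin n → Circle) (z : EuclideanSpace ℂ (Fin n)) (i : Fin n) :
    diagIsometry u z i = (u i : ℂ) * z i := rfl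

variable [NormedSpace ℂ F]

open Classical in
/-- The coefficient of `z ^ α` in the Taylor expansion of `f` at the origin, times `|α|!`. -/
noncomputable def taylorVector (f : EuclideanSpace ℂ (Fin n) → F) (α : Fin n → ℕ) : F :=
  ∑ σ : Fin (∑ i, α i) → Fin n with multiIndex σ = α,
    iteratedFDeriv ℂ (∑ i, α i) f 0 fun j => EuclideanSpace.single (σ j) 1

theorem euclideanSpace_eq_sum_single (z : EuclideanSpace ℂ (Fin n)) :
    z = ∑ i, z i • EuclideanSpace.single i (1 : ℂ) := by
  ext j
  simp [Finset.sum_apply, Pi.single_apply]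

theorem iteratedFDeriv_zero_apply_diag (f : EuclideanSpace ℂ (Fin n) → F) (k : ℕ)
    (z : EuclideanSpace ℂ (Fin n)) :
    iteratedFDeriv ℂ k f 0 (fun _ => z) =
      ∑ σ : Fin k → Fin n, (∏ i, z i ^ multiIndex σ i) •
        iteratedFDeriv ℂ k f 0 fun j => EuclideanSpace.single (σ j) 1 := by
  conv_lhs => rw [euclideanSpace_eq_sum_single z]
  rw [ContinuousMultilinearMap.map_sum]
  refine Finset.sum_congr rfl fun σ _ => ?_
  rw [ContinuousMultilinearMap.map_smul_univ, prod_comp_eq_prod_pow_multiIndex σ fun i => z i]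

open Classical in
/-- The homogeneous Taylor polynomials in terms of the monomials. -/
theorem iteratedFDeriv_zero_apply_diag_eq_sum (f : EuclideanSpace ℂ (Fin n) → F) (k : ℕ)
    (z : EuclideanSpace ℂ (Fin n)) :
    iteratedFDeriv ℂ k f 0 (fun _ => z) =
      ∑ α ∈ Finset.univ.image (multiIndex : (Fin k → Fin n) → Fin n → ℕ),
        (∏ i, z i ^ α i) • taylorVector f α := by
  rw [iteratedFDeriv_zero_apply_diag, ← Finset.sum_fiberwise_of_maps_to
    (fun σ _ => Finset.mem_image_of_mem multiIndex (Finset.mem_univ σ))]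
  refine Finset.sum_congr rfl fun α hα => ?_
  obtain ⟨τ, -, rfl⟩ := Finset.mem_image.1 hα
  have hk := sum_multiIndex τ
  rw [taylorVector, hk, Finset.smul_sum]
  exact Finset.sum_congr rfl fun σ hσ => by rw [(Finset.mem_filter.1 hσ).2]

/-- Differentiating `f ∘ u = U ∘ f` at 0 and evaluating on basis vectors, which `u` scales by `u i`,
produces the same factor `u ^ α` for every index sequence with multi-index `α`. -/
theorem taylorVector_equivariant [CompleteSpace F] {f : EuclideanSpace ℂ (Fin n) → F}
    (hf : AnalyticAt ℂ f 0) (u : Fin n → Circle) (U : F →L[ℂ] F)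
    (h : ∀ᶠ z in nhds 0, f (diagIsometry u z) = U (f z)) (α : Fin n → ℕ) :
    U (taylorVector f α) = ((∏ i, u i ^ α i : Circle) : ℂ) • taylorVector f α := by
  have h1 (k : ℕ) : U.compContinuousMultilinearMap (iteratedFDeriv ℂ k f 0) =
      (iteratedFDeriv ℂ k f 0).compContinuousLinearMap
        fun _ => (diagIsometry u : EuclideanSpace ℂ (Fin n) →L[ℂ] EuclideanSpace ℂ (Fin n)) := by
    have hl := U.iteratedFDeriv_comp_left (hf.contDiffAt (n := k)) (i := k) le_rfl
    have hr := (diagIsometry u).toContinuousLinearEquiv.iteratedFDerivWithin_comp_right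
      f uniqueDiffOn_univ (x := 0) (Set.mem_univ _) k
    simp only [Set.preimage_univ, iteratedFDerivWithin_univ, map_zero] at hr
    rw [← hl]
    refine Eq.trans (Filter.EventuallyEq.eq_of_nhds (Filter.EventuallyEq.iteratedFDeriv ℂ ?_ k)) hr
    filter_upwards [h] with z hz using hz.symm
  rw [taylorVector, map_sum, Finset.smul_sum]
  refine Finset.sum_congr rfl fun σ hσ => ?_
  have h2 := congrArg (fun m => m fun j => EuclideanSpace.single (σ j) (1 : ℂ)) (h1 (∑ i, α i))
  have h3 (i : Fin n) : diagIsometry u (EuclideanSpace.single i 1) =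
      (u i : ℂ) • EuclideanSpace.single i 1 := by
    ext j
    rw [diagIsometry_apply]
    by_cases hij : j = i
    · subst hij; simp
    · simp [hij]
  have h4 : (∏ j, (u (σ j) : ℂ)) = ((∏ i, u i ^ α i : Circle) : ℂ) := by
    have h5 : ∏ i, u i ^ α i = ∏ j, u (σ j) := by
      rw [prod_comp_eq_prod_pow_multiIndex, (Finset.mem_filter.1 hσ).2]
    rw [h5]
    exact (map_prod Circle.coeHom _ _).symm
  rw [← h4, ← ContinuousMultilinearMap.map_smul_univ]
  simp only [← h3]
  exact h2

theorem taylorVector_inner_eq_zero {F : Type*} [NormedAddCommGroup F] [InnerProductSpace ℂ F]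
    [CompleteSpace F] {f : EuclideanSpace ℂ (Fin n) → F} (hf : AnalyticAt ℂ f 0)
    (h : ∀ u : Fin n → Circle, ∃ U : F →ₗᵢ[ℂ] F,
      ∀ᶠ z in nhds 0, f (diagIsometry u z) = U (f z)) :
    Pairwise fun α β => inner ℂ (taylorVector f α) (taylorVector f β) = 0 := by
  intro α β hαβ
  obtain ⟨i, hi⟩ := Function.ne_iff.1 hαβ
  obtain ⟨w, hw⟩ := exists_circle_pow_ne_pow hi
  -- Rotating a single coordinate in which `α` and `β` differ already gives distinct eigenvalues.
  obtain ⟨U, hU⟩ := h (Pi.mulSingle i w)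
  have hp (γ : Fin n → ℕ) : ∏ j, (Pi.mulSingle i w : Fin n → Circle) j ^ γ j = w ^ γ i := by
    rw [Finset.prod_eq_single i (fun j _ hj => by simp [hj]) (by simp)]
    simp
  have h1 (γ : Fin n → ℕ) : U (taylorVector f γ) = ((w ^ γ i : Circle) : ℂ) • taylorVector f γ := by
    rw [← hp]
    exact taylorVector_equivariant hf _ U.toContinuousLinearMap hU γ
  have h2 := U.inner_map_map (taylorVector f α) (taylorVector f β)
  rw [h1, h1, inner_smul_left, inner_smul_right, ← mul_assoc] at h2
  by_contra hne
  have h3 := mul_right_cancel₀ hne (h2.trans (one_mul _).symm)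
  rw [← Circle.coe_inv_eq_conj, ← Circle.coe_mul, Circle.coe_eq_one, inv_mul_eq_one] at h3
  exact hw h3

theorem apply_iteratedFDeriv_zero_diag_of_taylorVector_eq_zero {f : EuclideanSpace ℂ (Fin n) → F}
    (ℓ : F →L[ℂ] ℂ) {α : Fin n → ℕ} (hα : ∀ β, β ≠ α → ℓ (taylorVector f β) = 0) (k : ℕ)
    (y : EuclideanSpace ℂ (Fin n)) :
    ℓ (iteratedFDeriv ℂ k f 0 fun _ => y) =
      if k = ∑ i, α i then ℓ (taylorVector f α) * ∏ i, y i ^ α i else 0 := by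
  classical
  rw [iteratedFDeriv_zero_apply_diag_eq_sum, map_sum]
  have hne : ∀ β, β ≠ α → ℓ ((∏ i, y i ^ β i) • taylorVector f β) = 0 := by
    intro β hβ
    rw [map_smul, hα β hβ, smul_zero]
  split_ifs with hkα
  · rw [Finset.sum_eq_single α (fun β _ hβ => hne β hβ), map_smul, smul_eq_mul, mul_comm]
    -- If no index sequence has multi-index `α`, the sum defining the Taylor vector is empty;
    -- whether this can occur need not be decided.
    intro hmem
    have h0 : taylorVector f α = 0 := by
      rw [taylorVector]
      subst hkα
      refine Finset.sum_eq_zero fun σ hσ => (hmem ?_).elim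
      exact Finset.mem_image.2 ⟨σ, Finset.mem_univ _, (Finset.mem_filter.1 hσ).2⟩
    rw [h0, smul_zero, map_zero]
  · refine Finset.sum_eq_zero fun β hβ => ?_
    obtain ⟨σ, -, rfl⟩ := Finset.mem_image.1 hβ
    refine hne _ fun h => hkα ?_
    rw [← h, sum_multiIndex]

theorem apply_eq_monomial_of_taylorVector_eq_zero {f : EuclideanSpace ℂ (Fin n) → F}
    [CompleteSpace F] (hf : AnalyticOnNhd ℂ f (ball 0 1)) (ℓ : F →L[ℂ] ℂ) {α : Fin n → ℕ}
    (hα : ∀ β, β ≠ α → ℓ (taylorVector f β) = 0) {z : EuclideanSpace ℂ (Fin n)}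
    (hz : z ∈ ball (0 : EuclideanSpace ℂ (Fin n)) 1) :
    ℓ (f z) = (Nat.factorial (∑ i, α i) : ℂ)⁻¹ * ℓ (taylorVector f α) * ∏ i, z i ^ α i := by
  have hlhs : AnalyticOnNhd ℂ (fun z => ℓ (f z)) (ball 0 1) :=
    fun z hz => (ℓ.analyticAt (f z)).comp (hf z hz)
  have hrhs : AnalyticOnNhd ℂ (fun z : EuclideanSpace ℂ (Fin n) =>
      (Nat.factorial (∑ i, α i) : ℂ)⁻¹ * ℓ (taylorVector f α) * ∏ i, z i ^ α i) (ball 0 1) := by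
    intro z _
    refine analyticAt_const.mul (Finset.analyticAt_fun_prod _ fun i _ => AnalyticAt.pow ?_ _)
    exact (EuclideanSpace.proj (𝕜 := ℂ) i).analyticAt z
  -- The Taylor series settles the equality only near 0; the identity theorem extends it to the
  -- ball.
  refine hlhs.eqOn_of_preconnected_of_eventuallyEq hrhs (convex_ball _ _).isPreconnected
    (mem_ball_self one_pos) ?_ hz
  obtain ⟨p, r, hp⟩ := hf 0 (mem_ball_self one_pos)
  filter_upwards [Metric.eball_mem_nhds (0 : EuclideanSpace ℂ (Fin n)) hp.r_pos] with y hy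
  have hs := (hp.hasSum_iteratedFDeriv hy).mapL ℓ
  simp only [zero_add, map_smul, apply_iteratedFDeriv_zero_diag_of_taylorVector_eq_zero ℓ hα] at hs
  refine (hs.unique (hasSum_single (∑ i, α i) fun k hk => ?_)).trans ?_
  · rw [if_neg hk, smul_zero]
  · rw [if_pos rfl, smul_eq_mul, mul_assoc]

/-- A torus-equivariant analytic map on the ball has monomial components with respect to a suitable
orthonormal basis. -/
theorem exists_orthonormalBasis_inner_eq_monomial {F : Type*} [NormedAddCommGroup F]
    [InnerProductSpace ℂ F] [FiniteDimensional ℂ F] {N : ℕ} (hN : Module.finrank ℂ F = N)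
    {f : EuclideanSpace ℂ (Fin n) → F} (hf : AnalyticOnNhd ℂ f (ball 0 1))
    (h : ∀ u : Fin n → Circle, ∃ U : F →ₗᵢ[ℂ] F,
      ∀ z ∈ ball (0 : EuclideanSpace ℂ (Fin n)) 1, f (diagIsometry u z) = U (f z)) :
    ∃ (b : OrthonormalBasis (Fin N) ℂ F) (c : Fin N → ℂ) (α : Fin N → Fin n → ℕ),
      ∀ z ∈ ball (0 : EuclideanSpace ℂ (Fin n)) 1, ∀ j,
        inner ℂ (b j) (f z) = c j * ∏ i, z i ^ α j i := by
  have : CompleteSpace F := FiniteDimensional.complete ℂ F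
  obtain ⟨b, α, hα⟩ := exists_orthonormalBasis_of_pairwise_inner_eq_zero hN (taylorVector f)
    (taylorVector_inner_eq_zero (hf 0 (mem_ball_self one_pos)) fun u => (h u).imp fun U hU => by
      filter_upwards [ball_mem_nhds (0 : EuclideanSpace ℂ (Fin n)) one_pos] with z hz
      exact hU z hz)
  exact ⟨b, _, α, fun z hz j =>
    apply_eq_monomial_of_taylorVector_eq_zero hf (innerSL ℂ (b j)) (hα j) hz⟩

end Taylor

/-! ### Automorphisms of the ball -/

theorem perm_inv_apply_self {α : Type*} (e : Equiv.Perm α) (x : α) : e⁻¹ (e x) = x :=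
  e.symm_apply_apply x

theorem perm_apply_inv_self {α : Type*} (e : Equiv.Perm α) (x : α) : e (e⁻¹ x) = x :=
  e.apply_symm_apply x

section BallAutomorphisms
variable {n m k : ℕ}

/-- The centre of the unit ball. -/
def ballCenter (n : ℕ) : UnitBall n := ⟨0, mem_ball_self one_pos⟩

theorem UnitBall.norm_lt_one (z : UnitBall n) : ‖z.1‖ < 1 := mem_ball_zero_iff.1 z.2

/-- A map between unit balls is analytic if it is the restriction of a function that is
analytic on the source ball. -/
def IsAnalyticBallMap (f : UnitBall n → UnitBall m) : Prop :=
  ∃ F : EuclideanSpace ℂ (Fin n) → EuclideanSpace ℂ (Fin m),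
    AnalyticOnNhd ℂ F (ball 0 1) ∧ ∀ z : UnitBall n, F z = (f z : EuclideanSpace ℂ (Fin m))

theorem IsAnalyticBallMap.comp {g : UnitBall m → UnitBall k} {f : UnitBall n → UnitBall m}
    (hg : IsAnalyticBallMap g) (hf : IsAnalyticBallMap f) :
    IsAnalyticBallMap (fun z => g (f z)) := by
  obtain ⟨G, hG, hGg⟩ := hg
  obtain ⟨F, hF, hFf⟩ := hf
  refine ⟨fun z => G (F z), fun z hz => (hG _ ?_).comp (hF z hz), fun z => ?_⟩
  · rw [hFf ⟨z, hz⟩]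
    exact (f ⟨z, hz⟩).2
  · change G (F z) = _
    rw [hFf z, hGg (f z)]

theorem IsHolomorphicBallMap.continuous {f : UnitBall n → UnitBall m}
    (hf : IsHolomorphicBallMap f) : Continuous f := by
  obtain ⟨F, hF, hFf⟩ := hf
  refine continuous_induced_rng.2 ?_
  have h := continuousOn_iff_continuous_domRestrict.1 hF.continuousOn
  exact h.congr hFf

theorem IsRationalBallMap.isAnalyticBallMap {f : UnitBall n → UnitBall m}
    (hf : IsRationalBallMap f) : IsAnalyticBallMap f := by
  obtain ⟨p, q, h⟩ := hf
  have heval (P : MvPolynomial (Fin n) ℂ) (z : EuclideanSpace ℂ (Fin n)) :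
      AnalyticAt ℂ (fun z : EuclideanSpace ℂ (Fin n) => MvPolynomial.eval (fun i => z i) P) z := by
    induction P using MvPolynomial.induction_on with
    | C c => simpa using analyticAt_const
    | add P Q hP hQ =>
      simp only [map_add]
      exact hP.add hQ
    | mul_X P i hP =>
      simp only [map_mul, MvPolynomial.eval_X]
      exact hP.mul ((EuclideanSpace.proj (𝕜 := ℂ) i).analyticAt z)
  refine ⟨fun z => WithLp.toLp 2 fun j =>
    MvPolynomial.eval (fun i => z i) (p j) / MvPolynomial.eval (fun i => z i) q, ?_, fun z => ?_⟩
  · intro z hz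
    have hpi : AnalyticAt ℂ (fun z : EuclideanSpace ℂ (Fin n) => fun j =>
        MvPolynomial.eval (fun i => z i) (p j) / MvPolynomial.eval (fun i => z i) q) z :=
      AnalyticAt.pi fun j => (heval (p j) z).div (heval q z) (h ⟨z, hz⟩).1
    exact ((PiLp.continuousLinearEquiv 2 ℂ fun _ : Fin m => ℂ).symm.toContinuousLinearMap.analyticAt
      _).comp hpi
  · ext j
    exact ((h z).2 j).symm

/-- The homeomorphism of the ball underlying an automorphism. -/
def ballAutHomeomorph (φ : BallAut n) : UnitBall n ≃ₜ UnitBall n where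
  toEquiv := φ.1
  continuous_toFun := φ.2.1.continuous
  continuous_invFun := φ.2.2.continuous

theorem isProperMap_ballAut (φ : BallAut n) : IsProperMap fun z => φ.1 z :=
  (ballAutHomeomorph φ).isProperMap

/-- The automorphism of the unit ball given by a Möbius transformation. -/
noncomputable def moebiusAut (a : UnitBall n) : BallAut n :=
  ⟨{ toFun := fun z => ⟨ballMoebius a.1 z.1, mem_ball_zero_iff.2
        (norm_ballMoebius_lt_one a.norm_lt_one z.norm_lt_one)⟩
     invFun := fun z => ⟨ballMoebius (-a.1) z.1, mem_ball_zero_iff.2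
        (norm_ballMoebius_lt_one (by simpa using a.norm_lt_one) z.norm_lt_one)⟩
     left_inv := fun z => Subtype.ext (ballMoebius_neg_ballMoebius a.norm_lt_one z.norm_lt_one)
     right_inv := fun z => Subtype.ext (by
      have h := ballMoebius_neg_ballMoebius (a := -a.1) (by simpa using a.norm_lt_one) z.norm_lt_one
      rwa [neg_neg] at h) },
    ⟨_, (analyticOnNhd_ballMoebius a.norm_lt_one).differentiableOn, fun _ => rfl⟩,
    ⟨_, (analyticOnNhd_ballMoebius (a := -a.1)
      (by simpa using a.norm_lt_one)).differentiableOn, fun _ => rfl⟩⟩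

theorem moebiusAut_center (a : UnitBall n) : (moebiusAut a).1 (ballCenter n) = a :=
  Subtype.ext (ballMoebius_zero a.1)

theorem moebiusAut_inv_self (a : UnitBall n) : (moebiusAut a)⁻¹.1 a = ballCenter n := by
  change (moebiusAut a).1⁻¹ a = _
  rw [Equiv.Perm.inv_eq_iff_eq, moebiusAut_center]

theorem isAnalyticBallMap_moebiusAut (a : UnitBall n) :
    IsAnalyticBallMap fun z => (moebiusAut a).1 z :=
  ⟨_, analyticOnNhd_ballMoebius a.norm_lt_one, fun _ => rfl⟩

/-- The automorphism of the unit ball given by a linear isometry. -/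
noncomputable def isometryAut (L : EuclideanSpace ℂ (Fin n) ≃ₗᵢ[ℂ] EuclideanSpace ℂ (Fin n)) :
    BallAut n :=
  ⟨{ toFun := fun z => ⟨L z.1, by simpa using z.norm_lt_one⟩
     invFun := fun z => ⟨L.symm z.1, by simpa using z.norm_lt_one⟩
     left_inv := fun z => Subtype.ext (L.symm_apply_apply z.1)
     right_inv := fun z => Subtype.ext (L.apply_symm_apply z.1) },
    ⟨L, L.toContinuousLinearEquiv.differentiable.differentiableOn, fun _ => rfl⟩,
    ⟨L.symm, L.symm.toContinuousLinearEquiv.differentiable.differentiableOn, fun _ => rfl⟩⟩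

theorem isometryAut_apply (L : EuclideanSpace ℂ (Fin n) ≃ₗᵢ[ℂ] EuclideanSpace ℂ (Fin n))
    (z : UnitBall n) : ((isometryAut L).1 z).1 = L z.1 := rfl

/-- Holomorphic self-maps of the ball fixing the centre do not increase the norm. -/
theorem IsHolomorphicBallMap.norm_apply_le {f : UnitBall n → UnitBall m}
    (hf : IsHolomorphicBallMap f) (h0 : f (ballCenter n) = ballCenter m) (z : UnitBall n) :
    ‖(f z).1‖ ≤ ‖z.1‖ := by
  obtain ⟨F, hF, hFf⟩ := hf
  rw [← hFf z]
  refine Complex.norm_le_norm_of_mapsTo_ball hF (fun w hw => ?_) ?_ z.norm_lt_one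
  · rw [hFf ⟨w, hw⟩]
    exact ball_subset_closedBall (f ⟨w, hw⟩).2
  · exact (hFf (ballCenter n)).trans (congrArg Subtype.val h0)

/-- **Cartan's theorem**: an automorphism of the ball fixing the centre is a linear isometry. -/
theorem exists_linearIsometry_of_map_center {ψ : BallAut n}
    (h0 : ψ.1 (ballCenter n) = ballCenter n) :
    ∃ L : EuclideanSpace ℂ (Fin n) →ₗᵢ[ℂ] EuclideanSpace ℂ (Fin n),
      ∀ z : UnitBall n, (ψ.1 z).1 = L z.1 := by
  have hnorm (z : UnitBall n) : ‖(ψ.1 z).1‖ = ‖z.1‖ := by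
    refine le_antisymm (ψ.2.1.norm_apply_le h0 z) ?_
    -- The Schwarz lemma for the inverse gives the opposite inequality.
    have h := ψ.2.2.norm_apply_le (Equiv.Perm.inv_eq_iff_eq.2 h0.symm) (ψ.1 z)
    rwa [perm_inv_apply_self] at h
  obtain ⟨F, hF, hFf⟩ := ψ.2.1
  obtain ⟨L, hL⟩ := exists_linearIsometry_of_norm_eq hF fun z hz => by
    rw [hFf ⟨z, hz⟩, hnorm]
  exact ⟨L, fun z => by rw [← hL z.1 z.2, hFf z]⟩

/-- Moving the image of the centre back to the centre leaves a linear isometry, so `φ` is a Möbius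
transformation after an isometry, and both factors are analytic. -/
theorem isAnalyticBallMap_ballAut (φ : BallAut n) : IsAnalyticBallMap fun z => φ.1 z := by
  set a := φ.1 (ballCenter n)
  obtain ⟨L, hL⟩ := exists_linearIsometry_of_map_center (ψ := (moebiusAut a)⁻¹ * φ)
    (moebiusAut_inv_self a)
  have hψ : IsAnalyticBallMap fun z => ((moebiusAut a)⁻¹ * φ).1 z :=
    ⟨L, fun z _ => L.toContinuousLinearMap.analyticAt z, fun z => (hL z).symm⟩
  have h := (isAnalyticBallMap_moebiusAut a).comp hψ
  have he : (fun z => (moebiusAut a).1 (((moebiusAut a)⁻¹ * φ).1 z)) = fun z => φ.1 z := by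
    funext z
    exact (moebiusAut a).1.apply_symm_apply _
  rwa [he] at h

theorem isometryAut_diagIsometry_mem_standardTorus (u : Fin n → Circle) :
    isometryAut (diagIsometry u) ∈ standardTorus n :=
  ⟨u, fun _ _ => rfl⟩

theorem apply_eq_of_mem_standardTorus {γ : BallAut n} {u : Fin n → Circle}
    (h : ∀ (z : UnitBall n) (i : Fin n), (γ.1 z).1 i = (u i : ℂ) * z.1 i) :
    γ = isometryAut (diagIsometry u) :=
  Subtype.ext (Equiv.ext fun z => Subtype.ext (PiLp.ext fun i => h z i))

end BallAutomorphisms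

/-! ### Torus symmetry and monomial maps -/

section Equivariance
variable {n N : ℕ}

theorem IsMonomialBallMap.apply_diagIsometry {g : UnitBall n → UnitBall N}
    (hg : IsMonomialBallMap g) (u : Fin n → Circle) :
    ∃ v : Fin N → Circle, ∀ z,
      g ((isometryAut (diagIsometry u)).1 z) = (isometryAut (diagIsometry v)).1 (g z) := by
  obtain ⟨c, α, h⟩ := hg
  refine ⟨fun j => ∏ i, u i ^ α j i, fun z => Subtype.ext (PiLp.ext fun j => ?_)⟩
  rw [isometryAut_apply, diagIsometry_apply, h, h]
  have hv : ((∏ i, u i ^ α j i : Circle) : ℂ) = ∏ i, (u i : ℂ) ^ α j i :=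
    map_prod Circle.coeHom _ _
  simp only [isometryAut_apply, diagIsometry_apply, mul_pow, Finset.prod_mul_distrib, hv]
  ring

theorem standardTorus_map_conj_le_of_sphericallyEquivalent {f g : UnitBall n → UnitBall N}
    (hg : IsMonomialBallMap g) (hfg : SphericallyEquivalent f g) :
    ∃ φ : BallAut n,
      (standardTorus n).map (MulAut.conj φ).toMonoidHom ≤ hermitianInvariantGroup f := by
  obtain ⟨φ, χ, h⟩ := hfg
  refine ⟨φ⁻¹, ?_⟩
  rintro _ ⟨γ, ⟨u, hu⟩, rfl⟩
  rw [apply_eq_of_mem_standardTorus hu]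
  obtain ⟨v, hv⟩ := hg.apply_diagIsometry u
  refine ⟨χ * isometryAut (diagIsometry v) * χ⁻¹, fun z => ?_⟩
  change f (φ.1⁻¹ ((isometryAut (diagIsometry u)).1 (φ.1⁻¹⁻¹ z))) =
    χ.1 ((isometryAut (diagIsometry v)).1 (χ.1⁻¹ (f z)))
  rw [h, h z, perm_apply_inv_self, perm_inv_apply_self, inv_inv, hv]

/-- An analytic ball map fixing the centre and compatible with the torus has monomial components
after a linear isometry of the target. -/
theorem exists_isometryAut_comp_isMonomialBallMap {h : UnitBall n → UnitBall N}
    (ha : IsAnalyticBallMap h) (h0 : h (ballCenter n) = ballCenter N)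
    (hΓ : standardTorus n ≤ hermitianInvariantGroup h) :
    ∃ V, IsMonomialBallMap fun z => (isometryAut V).1 (h z) := by
  obtain ⟨F, hF, hFh⟩ := ha
  obtain ⟨b, c, α, hb⟩ := exists_orthonormalBasis_inner_eq_monomial
    (finrank_euclideanSpace_fin (𝕜 := ℂ) (n := N)) hF fun u => by
      obtain ⟨ψ, hψ⟩ := hΓ (isometryAut_diagIsometry_mem_standardTorus u)
      -- Both `h` and the rotation fix the centre, hence so does `ψ`, and Cartan's theorem applies.
      have hψ0 : ψ.1 (ballCenter N) = ballCenter N := by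
        have hc : (isometryAut (diagIsometry u)).1 (ballCenter n) = ballCenter n :=
          Subtype.ext (map_zero (diagIsometry u))
        have := hψ (ballCenter n)
        rwa [hc, h0, eq_comm] at this
      obtain ⟨U, hU⟩ := exists_linearIsometry_of_map_center hψ0
      refine ⟨U, fun z hz => ?_⟩
      have h1 := congrArg Subtype.val (hψ ⟨z, hz⟩)
      rw [hU, ← hFh, ← hFh] at h1
      exact h1
  -- Taking coordinates in `b` is the isometry that turns the inner products with `b j` into
  -- components.
  refine ⟨b.repr, c, α, fun z j => ?_⟩
  rw [isometryAut_apply, OrthonormalBasis.repr_apply_apply, ← hFh z]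
  exact hb z.1 z.2 j

theorem exists_monomial_of_standardTorus_map_conj_le {f : UnitBall n → UnitBall N}
    (hf : IsAnalyticBallMap f) (hproper : IsProperMap f) {φ : BallAut n}
    (hφ : (standardTorus n).map (MulAut.conj φ).toMonoidHom ≤ hermitianInvariantGroup f) :
    ∃ g : UnitBall n → UnitBall N,
      IsProperMap g ∧ IsMonomialBallMap g ∧ SphericallyEquivalent f g := by
  -- Chosen so that `χ⁻¹ ∘ f ∘ φ` fixes the centre; precomposing with `φ` undoes the conjugation of
  -- the torus.
  set χ := moebiusAut (f (φ.1 (ballCenter n)))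
  have hΓ : standardTorus n ≤ hermitianInvariantGroup fun z => χ⁻¹.1 (f (φ.1 z)) := by
    intro γ hγ
    obtain ⟨ψ, hψ⟩ := hφ ⟨γ, hγ, rfl⟩
    refine ⟨χ⁻¹ * ψ * χ, fun z => ?_⟩
    have h1 : f (φ.1 (γ.1 (φ.1⁻¹ (φ.1 z)))) = ψ.1 (f (φ.1 z)) := hψ (φ.1 z)
    rw [perm_inv_apply_self] at h1
    change χ.1⁻¹ (f (φ.1 (γ.1 z))) = χ.1⁻¹ (ψ.1 (χ.1 (χ.1⁻¹ (f (φ.1 z)))))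
    rw [perm_apply_inv_self, h1]
  obtain ⟨V, hV⟩ := exists_isometryAut_comp_isMonomialBallMap
    ((isAnalyticBallMap_ballAut χ⁻¹).comp (hf.comp (isAnalyticBallMap_ballAut φ)))
    (moebiusAut_inv_self _) hΓ
  refine ⟨_, ?_, hV, φ⁻¹, χ * (isometryAut V)⁻¹, fun z => ?_⟩
  · exact (isProperMap_ballAut _).comp
      ((isProperMap_ballAut χ⁻¹).comp (hproper.comp (isProperMap_ballAut φ)))
  · change f z = χ.1 ((isometryAut V).1⁻¹ ((isometryAut V).1 (χ.1⁻¹ (f (φ.1 (φ.1⁻¹ z))))))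
    simp only [perm_inv_apply_self, perm_apply_inv_self]

end Equivariance

theorem theorem5p1 (n N : ℕ) (hn : 1 ≤ n) (hN : n ≤ N) (f : UnitBall n → UnitBall N)
    (hrat : IsRationalBallMap f) (hproper : IsProperMap f) :
    (∃ φ : BallAut n,
      (standardTorus n).map (MulAut.conj φ).toMonoidHom ≤ hermitianInvariantGroup f) ↔
    (∃ g : UnitBall n → UnitBall N,
      IsProperMap g ∧ IsMonomialBallMap g ∧ SphericallyEquivalent f g) := by
  constructor
  · rintro ⟨φ, hφ⟩
    exact exists_monomial_of_standardTorus_map_conj_le hrat.isAnalyticBallMap hproper hφ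
  · rintro ⟨g, -, hg, hfg⟩
    exact standardTorus_map_conj_le_of_sphericallyEquivalent hg hfg
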